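/- Let $q$ be a prime power, let $s\ge 1$ be an integer and let $\boldsymbol\beta=(\beta_m)_{m\ge1}$ be a sequence of positive real numbers with $\sum_{m\ge1}\beta_m<\infty$. Let $\mathbb F_q$ be the field of order $q$. Notation. Let $Y$ be the set of all $\alpha\in\mathbb F_q[[x]]$ with $\gcd(\alpha \bmod x^m,x^m)=1$ for all $m\ge1$, and let $\widetilde Y^s=\{(\alpha_1,\dots,\alpha_s)\in Y^s:\alpha_1=1\}$. Put $R_m=\mathbb F_q[x]/(x^m)$. For $1\le i\le s$ and $m\ge 1$ let $\mathfrak B_{m,i}=(\mathfrak b_{m,i,1},\dots,\mathfrak b_{m,i,m})$ be ordered $\mathbb F_q$-bases of $R_m$ that are compatible: in the coordinates with respect to $1,x,x^2,\dots$ one has $\mathfrak b_{m+1,i,j}=(\mathfrak b_{m,i,j},0)$ for $1\le j\le m$. Let $\theta_m:R_m^s\to\mathbb F_q^{sm}$ be the coordinate map with respect to $\mathfrak B_{m,1},\dots,\mathfrak B_{m,s}$. For $\boldsymbol\alpha\in Y^s$ let $\mathcal N_{m}(\boldsymbol\alpha)=\theta_m(\{\mathbf k\in R_m^s:\sum_{i=1}^s\alpha_ik_i\equiv0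 \pmod{x^m}\})$. Matrices $C_1,\dots,C_s\in\mathbb F_q^{\mathbb N\times\mathbb N}$ are generating matrices of a hyperplane sequence $\mathcal S_{\boldsymbol\alpha}$ associated with $\boldsymbol\alpha$ if for every $m\ge1$ the row space of $(C_1^{(m)\top}\,\cdots\,C_s^{(m)\top})\in\mathbb F_q^{m\times sm}$, where $C_i^{(m)}$ is the left-upper $m\times m$ submatrix of $C_i$, is the orthogonal complement of $\mathcal N_m(\boldsymbol\alpha)$ in $\mathbb F_q^{sm}$. Fix a bijection $\varphi:\{0,\dots,q-1\}\to\mathbb F_q$ with $\varphi(0)=0$. The digital sequence with generating matrices $C_1,\dots,C_s$ is the sequence of points $\boldsymbol x_k$, $k\ge0$, whose $i$-th coordinate is given by the base $q$ digit expansion $\sum_{j\ge1}\varphi^{-1}(y_{i,j}(k))q^{-j}$, where $(y_{i,j}(k))_{j\ge1}=C_i\,(\varphi(\kappa_0),\varphi(\kappa_1),\dots)^\top$ and $k=\kappa_0+\kappa_1q+\cdots$ with $\kappa_r\in\{0,\dots,q-1\}$. For integers $0\le t\le m$, a $(t,m,s)$-net in base $q$ is a family of $q^m$ points in $[0,1)^s$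 such that every interval $\prod_{i=1}^s[a_iq^{-d_i},(a_i+1)q^{-d_i})$ with integers $d_i\ge0$, $0\le a_i<q^{d_i}$ and of volume $q^{t-m}$ contains exactly $q^t$ of them. For $\mathbf T:\mathbb N_0\to\mathbb N_0$ with $\mathbf T(m)\le m$ for all $m$, the above sequence is a digital $(\mathbf T,s)$-sequence over $\mathbb F_q$ if for all $m,k\ge0$ the points $\boldsymbol x_n$ with $kq^m\le n<(k+1)q^m$, each truncated to the first $m$ digits of its given expansions, form a $(\mathbf T(m),m,s)$-net in base $q$. Theorem. There are an integer $L=L(s,q,\boldsymbol\beta)$ and an $\boldsymbol\alpha\in\widetilde Y^s$ such that, for every $\varphi$ and every system of compatible bases as above, hyperplane sequences $\mathcal S_{\boldsymbol\alpha}$ associated with $\boldsymbol\alpha$ exist, and every one of them is a digital $(\mathbf T,s)$-sequence over $\mathbb F_q$ for some $\mathbf T$ with $$\mathbf T(m)\le\log_q\frac{m^{s-1}}{\beta_m}+L\qquad\text{for all } m\ge1.$$ -/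

import Mathlib

/-!
Matrices, digits and coordinates are indexed from `0`: the index `j` stands for position `j + 1`
of the usual indexing by positive integers.
-/

namespace HyperplaneSeq

open Polynomial

noncomputable section

/-! ### Nets and sequences -/

/-- The `N = b ^ m` points `P 0, …, P (N - 1)` (counted with multiplicity) of `[0,1)^s` form a
`(t, m, s)`-net in base `b`: every elementary interval
`∏ i, [a i * b ^ (-d i), (a i + 1) * b ^ (-d i))` of volume `b ^ (t - m)`, that is with
`∑ i, d i + t = m`, contains exactly `b ^ t` of the points. -/
def IsNet (b t m s : ℕ) (P : Fin (b ^ m) → Fin s → ℝ) : Prop :=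
  t ≤ m ∧
  (∀ n i, P n i ∈ Set.Ico (0 : ℝ) 1) ∧
  ∀ d a : Fin s → ℕ, (∀ i, a i < b ^ d i) → (∑ i, d i) + t = m →
    Nat.card {n : Fin (b ^ m) // ∀ i, P n i ∈
      Set.Ico ((a i : ℝ) / (b : ℝ) ^ d i) (((a i : ℝ) + 1) / (b : ℝ) ^ d i)} = b ^ t

/-- The truncation `∑_{j = 1}^m x_j b^{-j}` of the number with given base `b` digit expansion
`0.x_1 x_2 x_3 …`, where `x_{j + 1}` is `x j`. -/
def truncDigits {b : ℕ} (m : ℕ) (x : ℕ → Fin b) : ℝ :=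
  ∑ j ∈ Finset.range m, ((x j : ℕ) : ℝ) / (b : ℝ) ^ (j + 1)

/-- The sequence of points whose `n`-th member has `i`-th coordinate given by the base `b` digit
expansion `x n i` is a `(T, s)`-sequence in base `b`. -/
def IsTSSequence (b s : ℕ) (T : ℕ → ℕ) (x : ℕ → Fin s → ℕ → Fin b) : Prop :=
  (∀ m, T m ≤ m) ∧
  ∀ m k : ℕ, IsNet b (T m) m s
    (fun n : Fin (b ^ m) => fun i => truncDigits m (x (k * b ^ m + (n : ℕ)) i))

/-! ### The digital method -/

/-- The `r`-th base `q` digit of `k`. -/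
def natDigit (q : ℕ) [NeZero q] (k r : ℕ) : Fin q := Fin.ofNat q (k / q ^ r)

/-- The digit expansions of the points of the digital sequence with generating matrices
`C 0, …, C (s - 1)`. As `φ 0 = 0` in all uses, the vector of the `φ (natDigit q k r)` has finite
support, so that the sum is finite. -/
def digitalSequence {q s : ℕ} [NeZero q] {F : Type*} [Field F] (φ : Fin q ≃ F)
    (C : Fin s → Matrix ℕ ℕ F) : ℕ → Fin s → ℕ → Fin q :=
  fun k i j => φ.symm (∑ᶠ r : ℕ, C i j r * φ (natDigit q k r))

/-- The generating matrices `C` give a digital `(T, s)`-sequence over `F`. -/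
def IsDigitalTSSequence {q s : ℕ} [NeZero q] {F : Type*} [Field F] (φ : Fin q ≃ F)
    (C : Fin s → Matrix ℕ ℕ F) (T : ℕ → ℕ) : Prop :=
  IsTSSequence q s T (digitalSequence φ C)

/-! ### Duality -/

/-- The `m`-th overall generating matrix: the transposes of the `m × m` left-upper submatrices of
`C 0, …, C (s - 1)`, side by side. The space `F^{sm}` is `Fin s × Fin m → F`, where `(i, j)` is the
`j`-th entry of the `i`-th block. -/
def overallMatrix {s : ℕ} {F : Type*} (C : Fin s → Matrix ℕ ℕ F) (m : ℕ) :
    Matrix (Fin m) (Fin s × Fin m) F :=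
  Matrix.of fun r ij => C ij.1 ij.2 r

/-- The row space of a matrix. -/
def rowSpace {m n F : Type*} [Field F] (A : Matrix m n F) : Submodule F (n → F) :=
  Submodule.span F (Set.range A.row)

/-- The orthogonal complement for the standard inner product `B ⬝ᵥ A = ∑ l, B l * A l`. -/
def dualSpace {n F : Type*} [Fintype n] [Field F] (N : Submodule F (n → F)) :
    Submodule F (n → F) where
  carrier := {A | ∀ B ∈ N, B ⬝ᵥ A = 0}
  add_mem' := by
    intro x y hx hy B hB
    rw [dotProduct_add, hx B hB, hy B hB, add_zero]
  zero_mem' := by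
    intro B _
    exact dotProduct_zero B
  smul_mem' := by
    intro c x hx B hB
    rw [dotProduct_smul, hx B hB, smul_zero]

/-! ### Hyperplane sequences -/

/-- The residue class ring `F[x] / (x ^ m)`. -/
abbrev R (F : Type*) [Field F] (m : ℕ) : Type _ := AdjoinRoot (X ^ m : F[X])

/-- The power series whose reduction modulo `x ^ m` is coprime to `x ^ m` for all `m ≥ 1`. -/
def Y (F : Type*) [Field F] : Set (PowerSeries F) :=
  {a | ∀ m : ℕ, 1 ≤ m → IsCoprime (PowerSeries.trunc m a) (X ^ m : F[X])}

/-- The reduction of a power series modulo `x ^ m`. -/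
def red {F : Type*} [Field F] (m : ℕ) (a : PowerSeries F) : R F m :=
  AdjoinRoot.mk (X ^ m : F[X]) (PowerSeries.trunc m a)

/-- The canonical representative, of degree less than `m`, of a residue class modulo `x ^ m`; its
coefficients are the coordinates with respect to `1, x, …, x ^ (m - 1)`. -/
def canonRep {F : Type*} [Field F] (m : ℕ) : R F m →ₗ[F] F[X] :=
  AdjoinRoot.modByMonicHom (monic_X_pow m)

/-- The ordered bases `B m i` of `F[x] / (x ^ m)` are compatible: in canonical coordinates, the
first `m` members of the basis `B (m + 1) i` are those of `B m i`, followed by a zero. -/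
def CompatibleBases {F : Type*} [Field F] {s : ℕ}
    (B : ∀ m : ℕ, Fin s → Module.Basis (Fin m) F (R F m)) : Prop :=
  ∀ m : ℕ, 1 ≤ m → ∀ (i : Fin s) (j : Fin m),
    canonRep (m + 1) (B (m + 1) i j.castSucc) = canonRep m (B m i j)

/-- The space of all `k ∈ (F[x] / (x ^ m))^s` with `α · k ≡ 0` modulo `x ^ m`. -/
def hyperplane {F : Type*} [Field F] {s : ℕ} (α : Fin s → PowerSeries F) (m : ℕ) :
    Submodule F (Fin s → R F m) where
  carrier := {k | ∑ i, red m (α i) * k i = 0}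
  add_mem' := by
    intro x y hx hy
    simp only [Set.mem_ofPred_eq] at hx hy
    simp only [Set.mem_ofPred_eq, Pi.add_apply, mul_add, Finset.sum_add_distrib, hx, hy, add_zero]
  zero_mem' := by simp
  smul_mem' := by
    intro c x hx
    simp only [Set.mem_ofPred_eq] at hx
    simp only [Set.mem_ofPred_eq, Pi.smul_apply, mul_smul_comm, ← Finset.smul_sum, hx, smul_zero]

/-- The coordinate map `(F[x] / (x ^ m))^s → F^{sm}` with respect to bases `b 0, …, b (s - 1)`. -/
def coordMap {F : Type*} [Field F] {s m : ℕ} (b : Fin s → Module.Basis (Fin m) F (R F m)) :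
    (Fin s → R F m) →ₗ[F] (Fin s × Fin m → F) :=
  LinearMap.pi fun ij => (b ij.1).coord ij.2 ∘ₗ LinearMap.proj ij.1

/-- `C` is a system of generating matrices of a hyperplane sequence associated with `α` (with
respect to the bases `B`): for all `m ≥ 1`, the row space of the `m`-th overall generating matrix is
the dual of the `m`-th member of the dual space chain defined by `α`. -/
def IsHyperplaneGenerating {F : Type*} [Field F] {s : ℕ}
    (B : ∀ m : ℕ, Fin s → Module.Basis (Fin m) F (R F m)) (α : Fin s → PowerSeries F)
    (C : Fin s → Matrix ℕ ℕ F) : Prop :=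
  ∀ m : ℕ, 1 ≤ m →
    rowSpace (overallMatrix C m) = dualSpace ((hyperplane α m).map (coordMap (B m)))

end

end HyperplaneSeq

/-! Duality turns the net property into a statement about polynomials. Within a block of `q ^ m`
points, lying in an elementary interval is an affine linear system in the lowest `m` digits, so the
net property follows once the leading `d i` rows of the generating matrices are jointly independent
for all `d` with `∑ d i = m - t` (`isNet_of_independent`). A dependence among these rows is a vector
of the dual chain, that is, polynomials `k i` of degree `< d i` with `∑ α i * k i ≡ 0` modulo `x ^
m` (`independent_of_hasQuality`). The `j`-th basis polynomial, counted from `0`, has degree at most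
`j`, so the resulting condition `HasQuality` involves neither the bases nor `φ`; hence one `α`
serves them all.

A good `α` is found by counting. Take `α = 1` at one index `z` and `α i = 1 + x * A i` elsewhere,
with random coefficients. Dividing a nontrivial solution by its largest common power `x ^ v` leaves
a solution modulo `x ^ (m - v)`. As the `α i` have nonzero constant terms, at least two of the
quotients have nonzero constant term (`exists_primitive_solution`). One of these two lies off `z`,
so a fixed quotient tuple is a solution with probability at most `q ^ (1 - (m - v))`
(`card_solutions_mul_le`). Both force `v < d i`, so at most `q ^ (m - t - 2 * v)` quotient tuples
occur. The product is `q ^ (1 - t - v)`. Summing over `v` and over at most `(m + 1) ^ (s - 1)`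
vectors `d`, quality `t` fails at `m` with probability at most `2 * q * (m + 1) ^ (s - 1) / q ^ t`
(`card_not_hasQuality_le`).

For `q ^ t ≥ q ^ L₀ * m ^ (s - 1) / β m` this is a constant times `β m / q ^ L₀`, and for large `L₀`
the sum over `m` is below `1`. Thus finitely many requirements can be met together, and compactness
of the coefficient space gives all of them. -/

namespace HyperplaneSeq

open Polynomial

/-! ### Fibres of surjective linear maps -/

/-- All fibres of a surjective linear map between finite spaces have the same cardinality. -/
theorem card_fiber_mul_card {K V W : Type*} [Ring K] [AddCommGroup V] [AddCommGroup W]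
    [Module K V] [Module K W] (f : V →ₗ[K] W) (hf : Function.Surjective f) (w : W) :
    Nat.card {v // f v = w} * Nat.card W = Nat.card V := by
  obtain ⟨v₀, rfl⟩ := hf w
  have e : {v // f v = f v₀} ≃ LinearMap.ker f :=
    { toFun := fun v => ⟨v.1 - v₀, by simp [v.2]⟩
      invFun := fun u => ⟨u.1 + v₀, by simp [LinearMap.mem_ker.1 u.2]⟩
      left_inv := fun v => by simp
      right_inv := fun u => by simp }
  rw [Nat.card_congr e, Submodule.card_eq_card_quotient_mul_card (LinearMap.ker f),
    Nat.card_congr (f.quotKerEquivOfSurjective hf).toEquiv]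

/-- A linear system with linearly independent rows has the expected number of solutions. -/
theorem card_solutions_of_linearIndependent {F m n : Type*} [Field F] [Finite F] [Fintype m]
    [Fintype n] (M : Matrix m n F) (hM : LinearIndependent F M.row) (w : m → F) :
    Nat.card {z // M.mulVec z = w} * Nat.card F ^ Fintype.card m
      = Nat.card F ^ Fintype.card n := by
  classical
  have hsurj : Function.Surjective M.mulVecLin := by
    rw [← LinearMap.range_eq_top]
    apply Submodule.eq_top_of_finrank_eq
    rw [Module.finrank_fintype_fun_eq_card]
    exact hM.rank_matrix
  have := card_fiber_mul_card M.mulVecLin hsurj w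
  simpa [Nat.card_fun] using this

/-! ### Digit expansions -/

theorem truncDigits_nonneg {b : ℕ} (m : ℕ) (x : ℕ → Fin b) : 0 ≤ truncDigits m x :=
  Finset.sum_nonneg fun _ _ => by positivity

theorem truncDigits_succ {b : ℕ} (m : ℕ) (x : ℕ → Fin b) :
    truncDigits (m + 1) x = truncDigits m x + ((x m : ℕ) : ℝ) / (b : ℝ) ^ (m + 1) :=
  Finset.sum_range_succ _ _

theorem truncDigits_mono {b : ℕ} {d m : ℕ} (h : d ≤ m) (x : ℕ → Fin b) :
    truncDigits d x ≤ truncDigits m x := by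
  induction m, h using Nat.le_induction with
  | base => rfl
  | succ m _ ih => rw [truncDigits_succ]; exact ih.trans (le_add_of_nonneg_right (by positivity))

/-- Digits are at most `b - 1`, so those in positions `d + 1, …, m` add at most `b ^ (-d) - b ^
(-m)`. The slack `b ^ (-m)` keeps truncated points strictly below the right end of their interval.
-/
theorem truncDigits_add_lt {b : ℕ} [NeZero b] {d m : ℕ} (h : d ≤ m) (x : ℕ → Fin b) :
    truncDigits m x + 1 / (b : ℝ) ^ m ≤ truncDigits d x + 1 / (b : ℝ) ^ d := by
  have hb : (0 : ℝ) < b := by exact_mod_cast Nat.pos_of_ne_zero (NeZero.ne b)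
  induction m, h using Nat.le_induction with
  | base => rfl
  | succ m _ ih =>
    refine le_trans ?_ ih
    rw [truncDigits_succ, add_assoc]
    gcongr
    rw [← add_div, div_le_div_iff₀ (by positivity) (by positivity), pow_succ]
    have : ((x m : ℕ) : ℝ) + 1 ≤ b := by exact_mod_cast (x m).2
    nlinarith [pow_pos hb m]

theorem truncDigits_mem_Ico {b : ℕ} [NeZero b] (m : ℕ) (x : ℕ → Fin b) :
    truncDigits m x ∈ Set.Ico (0 : ℝ) 1 := by
  have hb : (0 : ℝ) < b := by exact_mod_cast Nat.pos_of_ne_zero (NeZero.ne b)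
  refine ⟨truncDigits_nonneg m x, ?_⟩
  have h := truncDigits_add_lt (Nat.zero_le m) x
  have h0 : truncDigits 0 x = 0 := by simp [truncDigits]
  have : (0 : ℝ) < 1 / (b : ℝ) ^ m := by positivity
  rw [h0, pow_zero] at h
  linarith

/-- The integer with given leading base `b` digits, most significant digit first. -/
def leadingInt {b : ℕ} (x : ℕ → Fin b) : ℕ → ℕ
  | 0 => 0
  | d + 1 => b * leadingInt x d + x d

theorem truncDigits_eq_leadingInt {b : ℕ} [NeZero b] (d : ℕ) (x : ℕ → Fin b) :
    truncDigits d x = (leadingInt x d : ℝ) / (b : ℝ) ^ d := by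
  have hb : (b : ℝ) ≠ 0 := by exact_mod_cast NeZero.ne b
  induction d with
  | zero => simp [truncDigits, leadingInt]
  | succ d ih =>
    rw [truncDigits_succ, ih, leadingInt]
    push_cast
    field_simp
    ring

/-- Membership of a truncated expansion in an elementary interval is decided by the leading
digits. -/
theorem truncDigits_mem_Ico_iff {b : ℕ} [NeZero b] {d m : ℕ} (h : d ≤ m) (x : ℕ → Fin b) (a : ℕ) :
    truncDigits m x ∈ Set.Ico ((a : ℝ) / (b : ℝ) ^ d) (((a : ℝ) + 1) / (b : ℝ) ^ d) ↔
      leadingInt x d = a := by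
  have hb : (0 : ℝ) < b := by exact_mod_cast Nat.pos_of_ne_zero (NeZero.ne b)
  have h1 := truncDigits_mono h x
  have h2 := truncDigits_add_lt h x
  have h3 : (0 : ℝ) < 1 / (b : ℝ) ^ m := by positivity
  rw [truncDigits_eq_leadingInt d] at h1 h2
  rw [← add_div] at h2
  have h4 : truncDigits m x < ((leadingInt x d : ℝ) + 1) / (b : ℝ) ^ d := by linarith
  constructor
  · rintro ⟨h5, h6⟩
    have h7 := (div_lt_div_iff_of_pos_right (by positivity)).1 (h5.trans_lt h4)
    have h8 := (div_lt_div_iff_of_pos_right (by positivity)).1 (h1.trans_lt h6)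
    norm_cast at h7 h8
    omega
  · rintro rfl
    exact ⟨h1, h4⟩

theorem exists_digits_of_lt {b : ℕ} [NeZero b] (d a : ℕ) (ha : a < b ^ d) :
    ∃ y : ℕ → Fin b, ∀ x : ℕ → Fin b, leadingInt x d = a ↔ ∀ j < d, x j = y j := by
  have hb : 0 < b := Nat.pos_of_ne_zero (NeZero.ne b)
  induction d generalizing a with
  | zero => exact ⟨fun _ => 0, fun x => by simp_all [leadingInt]⟩
  | succ d ih =>
    obtain ⟨y, hy⟩ := ih (a / b) (Nat.div_lt_of_lt_mul (by rwa [pow_succ'] at ha))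
    refine ⟨Function.update y d ⟨a % b, Nat.mod_lt _ hb⟩, fun x => ?_⟩
    have key : leadingInt x (d + 1) = a ↔ leadingInt x d = a / b ∧ (x d : ℕ) = a % b := by
      rw [leadingInt]
      constructor
      · rintro rfl
        rw [Nat.mul_add_div hb, Nat.div_eq_of_lt (x d).2, Nat.mul_add_mod, Nat.mod_eq_of_lt (x d).2]
        simp
      · rintro ⟨h1, h2⟩
        rw [h1, h2, Nat.div_add_mod]
    rw [key, hy]
    constructor
    · rintro ⟨h1, h2⟩ j hj
      rcases Nat.lt_succ_iff_lt_or_eq.1 hj with hj | rfl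
      · rw [Function.update_of_ne hj.ne, h1 j hj]
      · rw [Function.update_self]; exact Fin.ext h2
    · intro h
      refine ⟨fun j hj => ?_, ?_⟩
      · rw [h j (by omega), Function.update_of_ne hj.ne]
      · rw [h d (by omega), Function.update_self]

theorem natDigit_val {q : ℕ} [NeZero q] (k r : ℕ) : (natDigit q k r : ℕ) = k / q ^ r % q := rfl

theorem natDigit_mul_add_of_lt {q : ℕ} [NeZero q] {m r : ℕ} (k n : ℕ) (hr : r < m) :
    natDigit q (k * q ^ m + n) r = natDigit q n r := by
  have hq : 0 < q := Nat.pos_of_ne_zero (NeZero.ne q)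
  obtain ⟨e, rfl⟩ := Nat.exists_eq_add_of_lt hr
  apply Fin.ext
  rw [natDigit_val, natDigit_val,
    show k * q ^ (r + e + 1) + n = q ^ r * (q * (k * q ^ e)) + n by ring,
    Nat.mul_add_div (by positivity), Nat.mul_add_mod]

theorem natDigit_mul_add_add {q : ℕ} [NeZero q] {m : ℕ} (k n r : ℕ) (hn : n < q ^ m) :
    natDigit q (k * q ^ m + n) (m + r) = natDigit q k r := by
  have hq : 0 < q := Nat.pos_of_ne_zero (NeZero.ne q)
  apply Fin.ext
  rw [natDigit_val, natDigit_val, pow_add, ← Nat.div_div_eq_div_mul, mul_comm k,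
    Nat.mul_add_div (by positivity), Nat.div_eq_of_lt hn, add_zero]

theorem natDigit_eq_zero {q : ℕ} [NeZero q] (hq : 1 < q) {k r : ℕ} (h : k ≤ r) :
    natDigit q k r = 0 := by
  apply Fin.ext
  rw [natDigit_val, Nat.div_eq_of_lt (h.trans_lt (Nat.lt_pow_self hq))]
  simp

/-- The digit vectors of the numbers below `q ^ m`, transported to `F`. -/
noncomputable def digitVectorEquiv {q : ℕ} [NeZero q] {F : Type*} (φ : Fin q ≃ F) (m : ℕ) :
    Fin (q ^ m) ≃ (Fin m → F) :=
  finFunctionFinEquiv.symm.trans (Equiv.arrowCongr (Equiv.refl _) φ)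

theorem digitVectorEquiv_apply {q : ℕ} [NeZero q] {F : Type*} (φ : Fin q ≃ F) (m : ℕ)
    (n : Fin (q ^ m)) (r : Fin m) : digitVectorEquiv φ m n r = φ (natDigit q n r) := rfl

/-- The lowest `m` digits of `k * q ^ m + n` are those of `n`, the others those of `k`. The second
sum is therefore constant on the block; `range k` suffices because `k < q ^ k`. -/
theorem finsum_digits {q : ℕ} [NeZero q] (hq : 1 < q) {F : Type*} [Field F] (φ : Fin q ≃ F)
    (hφ : φ 0 = 0) (c : ℕ → F) (m k : ℕ) (n : Fin (q ^ m)) :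
    ∑ᶠ r : ℕ, c r * φ (natDigit q (k * q ^ m + n) r) =
      ∑ r : Fin m, c r * digitVectorEquiv φ m n r
        + ∑ r ∈ Finset.range k, c (m + r) * φ (natDigit q k r) := by
  rw [finsum_eq_sum_of_support_subset (s := Finset.range (m + k)), Finset.sum_range_add,
    Finset.sum_range]
  · congr 1
    · exact Finset.sum_congr rfl fun r _ => by
        rw [digitVectorEquiv_apply, natDigit_mul_add_of_lt _ _ r.2]
    · exact Finset.sum_congr rfl fun r _ => by rw [natDigit_mul_add_add _ _ _ n.2]
  · intro r hr
    by_contra h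
    simp only [Finset.coe_range, Set.mem_Iio, not_lt] at h
    obtain ⟨e, rfl⟩ := Nat.exists_eq_add_of_le (le_of_add_le_left h)
    apply hr
    simp only
    rw [natDigit_mul_add_add _ _ _ n.2, natDigit_eq_zero hq (by omega), hφ, mul_zero]

/-! ### Nets from independent rows -/

/-- If the leading `d i` rows of the `m × m` left-upper submatrices are jointly linearly independent
whenever `∑ i, d i = m - t`, then all blocks of the digital sequence are `(t, m, s)`-nets. -/
theorem isNet_of_independent {q s : ℕ} [NeZero q] (hq : 1 < q) {F : Type*} [Field F]
    (φ : Fin q ≃ F) (hφ : φ 0 = 0) (C : Fin s → Matrix ℕ ℕ F) {t m : ℕ} (htm : t ≤ m)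
    (hC : ∀ d : Fin s → ℕ, (∑ i, d i) + t = m → ∀ g : (Σ i, Fin (d i)) → F,
      (∀ r : Fin m, ∑ ij, g ij * C ij.1 ij.2 r = 0) → g = 0) (k : ℕ) :
    IsNet q t m s (fun n : Fin (q ^ m) => fun i =>
      truncDigits m (digitalSequence φ C (k * q ^ m + (n : ℕ)) i)) := by
  refine ⟨htm, fun n i => truncDigits_mem_Ico _ _, fun d a ha hd => ?_⟩
  have hdm : ∀ i, d i ≤ m := fun i =>
    (Finset.single_le_sum (fun _ _ => Nat.zero_le _) (Finset.mem_univ i)).trans (by omega)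
  choose y hy using fun i => exists_digits_of_lt (d i) (a i) (ha i)
  let M : Matrix (Σ i, Fin (d i)) (Fin m) F := Matrix.of fun ij r => C ij.1 ij.2 r
  -- Prescribed leading digits, corrected by the fixed contribution of the block number `k`: only
  -- the right-hand side of the system depends on the block.
  let w : (Σ i, Fin (d i)) → F := fun ij =>
    φ (y ij.1 ij.2) - ∑ r ∈ Finset.range k, C ij.1 ij.2 (m + r) * φ (natDigit q k r)
  have hM : LinearIndependent F M.row := by
    rw [Fintype.linearIndependent_iff]
    intro g hg ij
    refine congrFun (hC d hd g fun r => ?_) ij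
    simpa [M] using congrFun hg r
  have hcardF : Nat.card F = q := by rw [← Nat.card_congr φ, Nat.card_fin]
  have : Finite F := Finite.of_equiv _ φ
  have hcount := card_solutions_of_linearIndependent M hM w
  rw [hcardF, Fintype.card_sigma, Fintype.card_fin] at hcount
  simp only [Fintype.card_fin] at hcount
  have hqpos : 0 < q := by omega
  have hcount' := Nat.eq_of_mul_eq_mul_right (by positivity)
    (hcount.trans (show q ^ m = q ^ t * q ^ ∑ i, d i by rw [← pow_add, add_comm, hd]))
  rw [← hcount']
  refine Nat.card_congr ((digitVectorEquiv φ _).subtypeEquiv fun n => ?_)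
  rw [funext_iff, Sigma.forall]
  refine forall_congr' fun i => ?_
  rw [truncDigits_mem_Ico_iff (hdm i), hy]
  constructor
  · intro h j
    have := h j j.2
    rw [digitalSequence, Equiv.symm_apply_eq, finsum_digits hq φ hφ] at this
    exact eq_sub_of_add_eq this
  · intro h j hj
    have := h ⟨j, hj⟩
    rw [digitalSequence, Equiv.symm_apply_eq, finsum_digits hq φ hφ]
    exact add_eq_of_eq_sub this

/-! ### Duality -/

theorem dualSpace_dualSpace {n F : Type*} [Fintype n] [Field F] (N : Submodule F (n → F)) :
    dualSpace (dualSpace N) = N := by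
  classical
  let b : LinearMap.BilinForm F (n → F) := dotProductBilin F F
  have hb : ∀ x y, b x y = x ⬝ᵥ y := fun _ _ => rfl
  have hrefl : b.IsRefl := fun x y h => by rwa [hb, dotProduct_comm, ← hb]
  have hnd : b.Nondegenerate := by
    constructor
    · intro x hx
      funext i
      simpa [hb] using hx (Pi.single i 1)
    · intro x hx
      funext i
      simpa [hb] using hx (Pi.single i 1)
  have h : ∀ W, dualSpace W = b.orthogonal W := fun W => rfl
  rw [h, h, LinearMap.BilinForm.orthogonal_orthogonal hnd hrefl]

theorem mem_dualSpace_rowSpace {m n F : Type*} [Fintype n] [Field F] (M : Matrix m n F)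
    (A : n → F) : A ∈ dualSpace (rowSpace M) ↔ ∀ r, ∑ l, A l * M r l = 0 := by
  constructor
  · intro h r
    have := h (M.row r) (Submodule.subset_span ⟨r, rfl⟩)
    rw [dotProduct_comm] at this
    exact this
  · intro h B hB
    induction hB using Submodule.span_induction with
    | mem x hx =>
      obtain ⟨r, rfl⟩ := hx
      rw [dotProduct_comm]
      exact h r
    | zero => exact zero_dotProduct A
    | add x y _ _ hx hy => rw [add_dotProduct, hx, hy, add_zero]
    | smul c x _ hx => rw [smul_dotProduct, hx, smul_zero]

/-! ### Compatible bases and hyperplanes in polynomial terms -/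

section

variable {F : Type*} [Field F] {s : ℕ}

theorem mk_canonRep (m : ℕ) (a : R F m) : AdjoinRoot.mk (X ^ m : F[X]) (canonRep m a) = a :=
  AdjoinRoot.mk_leftInverse (monic_X_pow m) a

theorem canonRep_injective (m : ℕ) : Function.Injective (canonRep (F := F) m) :=
  (AdjoinRoot.mk_leftInverse (monic_X_pow m)).injective

theorem degree_canonRep_lt (m : ℕ) (a : R F m) : (canonRep m a).degree < m := by
  obtain ⟨f, rfl⟩ := AdjoinRoot.mk_surjective a
  rw [canonRep, AdjoinRoot.modByMonicHom_mk]
  simpa using degree_modByMonic_lt f (monic_X_pow (R := F) m)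

/-- The polynomials underlying a compatible system of bases. -/
noncomputable def basisPoly (B : ∀ m : ℕ, Fin s → Module.Basis (Fin m) F (R F m)) (i : Fin s)
    (j : ℕ) : F[X] :=
  canonRep (j + 1) (B (j + 1) i (Fin.last j))

/-- Compatibility makes the `j`-th basis polynomial the same for every `m > j`; it can be read off
at `m = j + 1`, which bounds its degree by `j`. -/
theorem canonRep_basis {B : ∀ m : ℕ, Fin s → Module.Basis (Fin m) F (R F m)}
    (hB : CompatibleBases B) (m : ℕ) (i : Fin s) (j : Fin m) :
    canonRep m (B m i j) = basisPoly B i j := by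
  induction m with
  | zero => exact j.elim0
  | succ m ih =>
    induction j using Fin.lastCases with
    | last => rfl
    | cast j => rw [hB m (by have := j.2; omega) i j, ih]; rfl

theorem degree_basisPoly_lt (B : ∀ m : ℕ, Fin s → Module.Basis (Fin m) F (R F m)) (i : Fin s)
    (j : ℕ) : (basisPoly B i j).degree < (j + 1 : ℕ) :=
  degree_canonRep_lt _ _

theorem red_mul_mk (m : ℕ) (a : PowerSeries F) (p : F[X]) :
    red m a * AdjoinRoot.mk (X ^ m : F[X]) p = AdjoinRoot.mk _ (PowerSeries.trunc m a * p) :=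
  (map_mul _ _ _).symm

theorem X_pow_dvd_trunc_mul_sub (m : ℕ) (a : PowerSeries F) (p : F[X]) :
    (PowerSeries.X : PowerSeries F) ^ m ∣
      ((PowerSeries.trunc m a * p : F[X]) : PowerSeries F) - a * (p : PowerSeries F) := by
  rw [Polynomial.coe_mul, ← sub_mul]
  refine Dvd.dvd.mul_right ?_ _
  rw [PowerSeries.X_pow_dvd_iff]
  intro l hl
  rw [map_sub, Polynomial.coeff_coe, PowerSeries.coeff_trunc, if_pos hl, sub_self]

theorem coe_X_pow_dvd_iff (m : ℕ) (p : F[X]) :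
    (PowerSeries.X : PowerSeries F) ^ m ∣ (p : PowerSeries F) ↔ (X ^ m : F[X]) ∣ p := by
  rw [PowerSeries.X_pow_dvd_iff, Polynomial.X_pow_dvd_iff]
  simp

theorem coe_sum_powerSeries {ι : Type*} (u : Finset ι) (p : ι → F[X]) :
    ((∑ i ∈ u, p i : F[X]) : PowerSeries F) = ∑ i ∈ u, (p i : PowerSeries F) := by
  rw [← Polynomial.coeToPowerSeries.ringHom_apply, map_sum]
  simp

theorem sum_red_mul_mk_eq_zero_iff (m : ℕ) (α : Fin s → PowerSeries F) (p : Fin s → F[X]) :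
    ∑ i, red m (α i) * AdjoinRoot.mk (X ^ m : F[X]) (p i) = 0 ↔
      (PowerSeries.X : PowerSeries F) ^ m ∣ ∑ i, α i * (p i : PowerSeries F) := by
  simp_rw [red_mul_mk]
  rw [← map_sum, AdjoinRoot.mk_eq_zero, ← coe_X_pow_dvd_iff]
  have h : (PowerSeries.X : PowerSeries F) ^ m ∣
      ((∑ i, PowerSeries.trunc m (α i) * p i : F[X]) : PowerSeries F)
        - ∑ i, α i * (p i : PowerSeries F) := by
    rw [coe_sum_powerSeries, ← Finset.sum_sub_distrib]
    exact Finset.dvd_sum fun i _ => X_pow_dvd_trunc_mul_sub m (α i) (p i)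
  exact dvd_iff_dvd_of_dvd_sub h

theorem mem_map_coordMap_hyperplane_iff
    {B : ∀ m : ℕ, Fin s → Module.Basis (Fin m) F (R F m)} (hB : CompatibleBases B)
    (α : Fin s → PowerSeries F) (m : ℕ) (A : Fin s × Fin m → F) :
    A ∈ (hyperplane α m).map (coordMap (B m)) ↔
      (PowerSeries.X : PowerSeries F) ^ m ∣
        ∑ i, α i * ((∑ j : Fin m, A (i, j) • basisPoly B i j : F[X]) : PowerSeries F) := by
  have hmk : ∀ i, ∑ j, A (i, j) • B m i j
      = AdjoinRoot.mk (X ^ m : F[X]) (∑ j : Fin m, A (i, j) • basisPoly B i j) := by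
    intro i
    rw [← mk_canonRep m (∑ j, A (i, j) • B m i j), map_sum]
    simp_rw [map_smul, canonRep_basis hB]
  rw [← sum_red_mul_mk_eq_zero_iff]
  simp_rw [← hmk]
  constructor
  · rintro ⟨k, hk, rfl⟩
    have : ∀ i, ∑ j, coordMap (B m) k (i, j) • B m i j = k i := fun i => (B m i).sum_repr (k i)
    simp_rw [this]
    exact hk
  · intro h
    refine ⟨fun i => ∑ j, A (i, j) • B m i j, h, ?_⟩
    funext ij
    exact congrFun (((B m ij.1).repr_sum_self fun j => A (ij.1, j))) ij.2

/-- The canonical generating matrices of a hyperplane sequence. -/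
noncomputable def canonicalMatrices (B : ∀ m : ℕ, Fin s → Module.Basis (Fin m) F (R F m))
    (α : Fin s → PowerSeries F) : Fin s → Matrix ℕ ℕ F :=
  fun i => Matrix.of fun j r => PowerSeries.coeff r (α i * (basisPoly B i j : PowerSeries F))

/-- Divisibility of `∑ α i * k i` by `x ^ m` says that the coefficients `r < m` vanish. Each is a
linear form in the coordinates of `k`, and its coefficients form row `r` of the overall matrix. They
do not depend on `m`, so one system of infinite matrices works. -/
theorem isHyperplaneGenerating_canonicalMatrices
    {B : ∀ m : ℕ, Fin s → Module.Basis (Fin m) F (R F m)} (hB : CompatibleBases B)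
    (α : Fin s → PowerSeries F) : IsHyperplaneGenerating B α (canonicalMatrices B α) := by
  intro m _
  rw [← dualSpace_dualSpace (rowSpace _)]
  congr 1
  ext A
  rw [mem_dualSpace_rowSpace, mem_map_coordMap_hyperplane_iff hB, PowerSeries.X_pow_dvd_iff,
    Fin.forall_iff]
  refine forall₂_congr fun r hr => ?_
  rw [Fintype.sum_prod_type, map_sum]
  refine Eq.congr_left (Finset.sum_congr rfl fun i _ => ?_)
  have : ((∑ j : Fin m, A (i, j) • basisPoly B i j : F[X]) : PowerSeries F)
      = ∑ j : Fin m, A (i, j) • (basisPoly B i j : PowerSeries F) := by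
    rw [coe_sum_powerSeries]
    simp
  rw [this, Finset.mul_sum, map_sum]
  refine Finset.sum_congr rfl fun j _ => ?_
  rw [mul_smul_comm, map_smul, smul_eq_mul]
  rfl

/-! ### The figure of merit -/

/-- There are no nontrivial solutions of `α · k ≡ 0` modulo `x ^ m` with `deg k i < d i` and
`∑ i, d i = m - t`. -/
def HasQuality (α : Fin s → PowerSeries F) (m t : ℕ) : Prop :=
  ∀ d : Fin s → ℕ, (∑ i, d i) + t = m → ∀ k : Fin s → F[X], (∀ i, (k i).degree < d i) →
    (PowerSeries.X : PowerSeries F) ^ m ∣ ∑ i, α i * (k i : PowerSeries F) → k = 0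

theorem hasQuality_self (α : Fin s → PowerSeries F) (m : ℕ) : HasQuality α m m := by
  intro d hd k hk _
  have hd0 : ∑ i, d i = 0 := by omega
  funext i
  have := hk i
  rw [Finset.sum_eq_zero_iff.1 hd0 i (Finset.mem_univ i)] at this
  simpa using this

theorem independent_of_hasQuality
    {B : ∀ m : ℕ, Fin s → Module.Basis (Fin m) F (R F m)} (hB : CompatibleBases B)
    {α : Fin s → PowerSeries F} {C : Fin s → Matrix ℕ ℕ F} (hC : IsHyperplaneGenerating B α C)
    {m t : ℕ} (hα : HasQuality α m t) (d : Fin s → ℕ) (hd : (∑ i, d i) + t = m)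
    (g : (Σ i, Fin (d i)) → F) (hg : ∀ r : Fin m, ∑ ij, g ij * C ij.1 ij.2 r = 0) : g = 0 := by
  have hdm : ∀ i, d i ≤ m := fun i =>
    (Finset.single_le_sum (fun _ _ => Nat.zero_le _) (Finset.mem_univ i)).trans (by omega)
  -- The generating condition says nothing at `m = 0`, but there all `d i` vanish.
  rcases Nat.eq_zero_or_pos m with rfl | hm
  · funext ⟨i, j⟩
    have := hdm i
    have := j.2
    omega
  let A : Fin s × Fin m → F := fun ij =>
    if h : (ij.2 : ℕ) < d ij.1 then g ⟨ij.1, ij.2, h⟩ else 0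
  have hA : A ∈ (hyperplane α m).map (coordMap (B m)) := by
    rw [← dualSpace_dualSpace (Submodule.map _ _), ← hC m hm, mem_dualSpace_rowSpace]
    intro r
    rw [← hg r, Fintype.sum_prod_type, Fintype.sum_sigma]
    refine Finset.sum_congr rfl fun i _ => ?_
    rw [← Finset.sum_subset (Finset.subset_univ
      (Finset.univ.map (Fin.castLEEmb (hdm i)))), Finset.sum_map]
    · refine Finset.sum_congr rfl fun j _ => ?_
      simp [A, overallMatrix]
    · intro j _ hj
      have : ¬ (j : ℕ) < d i := fun h => hj (by
        rw [Finset.mem_map]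
        exact ⟨⟨j, h⟩, Finset.mem_univ _, rfl⟩)
      simp [A, this]
  rw [mem_map_coordMap_hyperplane_iff hB] at hA
  have h0 := hα d hd _ (fun i => ?_) hA
  · funext ⟨i, j⟩
    have h1 : ∑ j, A (i, j) • B m i j = 0 := by
      apply canonRep_injective m
      rw [map_sum, map_zero]
      simp_rw [map_smul, canonRep_basis hB]
      exact congrFun h0 i
    have h2 := Fintype.linearIndependent_iff.1 (B m i).linearIndependent (fun j => A (i, j)) h1
      (Fin.castLE (hdm i) j)
    simpa [A] using h2
  · rw [← Polynomial.mem_degreeLT]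
    refine Submodule.sum_mem _ fun j _ => ?_
    by_cases h : (j : ℕ) < d i
    · refine Submodule.smul_mem _ _ ?_
      rw [Polynomial.mem_degreeLT]
      exact (degree_basisPoly_lt B i j).trans_le (by exact_mod_cast h)
    · simp [A, h]

theorem isDigitalTSSequence_of_hasQuality {q : ℕ} [NeZero q] (hq : 1 < q) (φ : Fin q ≃ F)
    (hφ : φ 0 = 0) {B : ∀ m : ℕ, Fin s → Module.Basis (Fin m) F (R F m)} (hB : CompatibleBases B)
    {α : Fin s → PowerSeries F} {C : Fin s → Matrix ℕ ℕ F} (hC : IsHyperplaneGenerating B α C)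
    {T : ℕ → ℕ} (hT : ∀ m, T m ≤ m) (hα : ∀ m, HasQuality α m (T m)) :
    IsDigitalTSSequence φ C T :=
  ⟨hT, fun m k => isNet_of_independent hq φ hφ C (hT m)
    (fun d hd g hg => independent_of_hasQuality hB hC (hα m) d hd g hg) k⟩

end

/-! ### Counting tuples of power series without quality -/

section

variable {F : Type*} [Field F] {s : ℕ}

/-- Only `α` modulo `x ^ m` matters, so quality at `m` depends on finitely many coefficients. -/
theorem HasQuality.congr {α α' : Fin s → PowerSeries F} {m t : ℕ}
    (h : ∀ i, (PowerSeries.X : PowerSeries F) ^ m ∣ α i - α' i) (hα : HasQuality α m t) :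
    HasQuality α' m t := by
  intro d hd k hk hdvd
  refine hα d hd k hk ?_
  rw [← sub_add_cancel (∑ i, α i * (k i : PowerSeries F)) (∑ i, α' i * (k i : PowerSeries F)),
    ← Finset.sum_sub_distrib]
  refine dvd_add (Finset.dvd_sum fun i _ => ?_) hdvd
  rw [← sub_mul]
  exact (h i).mul_right _

/-- The largest common power of `X` can be divided out of a nonzero tuple of polynomials. -/
theorem exists_eq_X_pow_mul (k : Fin s → F[X]) (hk : k ≠ 0) :
    ∃ (v : ℕ) (k' : Fin s → F[X]), (∀ i, k i = X ^ v * k' i) ∧ ∃ i, (k' i).coeff 0 ≠ 0 := by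
  classical
  obtain ⟨i₁, hi₁⟩ := Function.ne_iff.1 hk
  obtain ⟨i₀, hi₀, hmin⟩ := Finset.exists_min_image (Finset.univ.filter fun i => k i ≠ 0)
    (fun i => (k i).natTrailingDegree) ⟨i₁, by simpa using hi₁⟩
  have hdvd : ∀ i, X ^ (k i₀).natTrailingDegree ∣ k i := by
    intro i
    rw [Polynomial.X_pow_dvd_iff]
    intro l hl
    by_cases h : k i = 0
    · rw [h, coeff_zero]
    · exact coeff_eq_zero_of_lt_natTrailingDegree (hl.trans_le (hmin i (by simpa using h)))
  choose k' hk' using hdvd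
  refine ⟨_, k', hk', i₀, ?_⟩
  have h0 : k i₀ ≠ 0 := by simpa using hi₀
  have h1 := trailingCoeff_nonzero_iff_nonzero.2 h0
  rw [trailingCoeff] at h1
  intro h2
  apply h1
  have h3 := coeff_X_pow_mul (k' i₀) (k i₀).natTrailingDegree 0
  rwa [← hk', zero_add, h2] at h3

/-- A nontrivial solution gives a solution that is primitive at the origin, at the cost of
decreasing the modulus. -/
theorem exists_primitive_solution {α : Fin s → PowerSeries F} (z : Fin s)
    (hα : ∀ i, PowerSeries.constantCoeff (α i) ≠ 0) {m : ℕ} {d : Fin s → ℕ} (hd : ∑ i, d i ≤ m)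
    {k : Fin s → F[X]} (hk : ∀ i, (k i).degree < d i) (hk0 : k ≠ 0)
    (hdvd : (PowerSeries.X : PowerSeries F) ^ m ∣ ∑ i, α i * (k i : PowerSeries F)) :
    ∃ (v : ℕ) (k' : Fin s → F[X]), v < m ∧ (∀ i, (k' i).degree < (d i - v : ℕ)) ∧
      (∃ i, i ≠ z ∧ (k' i).coeff 0 ≠ 0) ∧
      (∑ i, (d i - v)) + 2 * v ≤ ∑ i, d i ∧
      (PowerSeries.X : PowerSeries F) ^ (m - v) ∣ ∑ i, α i * (k' i : PowerSeries F) := by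
  classical
  obtain ⟨v, k', hkk', i₁, hi₁⟩ := exists_eq_X_pow_mul k hk0
  have hdeg : ∀ i, k' i ≠ 0 → v < d i ∧ (k' i).degree < (d i - v : ℕ) := by
    intro i hi
    have h := hk i
    rw [hkk' i, degree_mul, degree_X_pow, degree_eq_natDegree hi] at h
    rw [degree_eq_natDegree hi]
    norm_cast at h ⊢
    omega
  have hne : ∀ i, (k' i).coeff 0 ≠ 0 → k' i ≠ 0 := fun i h h' => h (by rw [h', coeff_zero])
  have hvm : v < m := (hdeg i₁ (hne i₁ hi₁)).1.trans_le
    ((Finset.single_le_sum (fun _ _ => Nat.zero_le _) (Finset.mem_univ i₁)).trans hd)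
  have hdvd' : (PowerSeries.X : PowerSeries F) ^ (m - v) ∣ ∑ i, α i * (k' i : PowerSeries F) := by
    have h : ∑ i, α i * (k i : PowerSeries F)
        = PowerSeries.X ^ v * ∑ i, α i * (k' i : PowerSeries F) := by
      rw [Finset.mul_sum]
      refine Finset.sum_congr rfl fun i _ => ?_
      rw [hkk' i, Polynomial.coe_mul, Polynomial.coe_pow, Polynomial.coe_X]
      ring
    rw [h, ← pow_mul_pow_sub _ hvm.le] at hdvd
    exact (mul_dvd_mul_iff_left (pow_ne_zero _ PowerSeries.X_ne_zero)).1 hdvd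
  have hconst : ∑ i, PowerSeries.constantCoeff (α i) * (k' i).coeff 0 = 0 := by
    have h := PowerSeries.X_pow_dvd_iff.1 hdvd' 0 (by omega)
    simpa [PowerSeries.coeff_zero_eq_constantCoeff_apply] using h
  -- A single nonzero constant term could not cancel in `hconst`. For `s = 1` this already excludes
  -- nontrivial solutions.
  obtain ⟨i₂, hi₂, hi₂0⟩ : ∃ i, i ≠ i₁ ∧ (k' i).coeff 0 ≠ 0 := by
    by_contra! h
    rw [Finset.sum_eq_single i₁ (fun i _ hi => by rw [h i hi, mul_zero])
      (fun h => absurd (Finset.mem_univ _) h)] at hconst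
    exact mul_ne_zero (hα i₁) hi₁ hconst
  refine ⟨v, k', hvm, fun i => ?_, ?_, ?_, hdvd'⟩
  · by_cases h : k' i = 0
    · rw [h, degree_zero]
      exact WithBot.bot_lt_coe _
    · exact (hdeg i h).2
  · by_cases h : i₁ = z
    · exact ⟨i₂, h ▸ hi₂, hi₂0⟩
    · exact ⟨i₁, h, hi₁⟩
  · have h1 := (hdeg i₁ (hne i₁ hi₁)).1
    have h2 := (hdeg i₂ (hne i₂ hi₂0)).1
    -- At `i₁` and `i₂` the truncated subtraction removes the full `v`. Saving `2 * v` instead of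
    -- `v` yields geometric decay in `v`, avoiding an extra factor `m` in the count.
    have h3 : ∑ i, ((d i - v) + (if i = i₁ then v else 0) + (if i = i₂ then v else 0))
        ≤ ∑ i, d i := by
      refine Finset.sum_le_sum fun i _ => ?_
      by_cases h4 : i = i₁
      · subst h4
        rw [if_pos rfl, if_neg (Ne.symm hi₂)]
        omega
      · rw [if_neg h4]
        split_ifs with h5
        · subst h5; omega
        · omega
    simp only [Finset.sum_add_distrib, Finset.sum_ite_eq', Finset.mem_univ, if_true] at h3
    omega

/-- The tuple with entry `1` at `z` and entries `1 + x * A i` elsewhere. -/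
noncomputable def oneAddTuple (z : Fin s) (A : Fin s → ℕ → F) : Fin s → PowerSeries F :=
  fun i => if i = z then 1 else 1 + PowerSeries.X * PowerSeries.mk (A i)

theorem constantCoeff_oneAddTuple (z : Fin s) (A : Fin s → ℕ → F) (i : Fin s) :
    PowerSeries.constantCoeff (oneAddTuple z A i) = 1 := by
  rw [oneAddTuple]
  split_ifs <;> simp

/-- Extension of a finite sequence by zeros. -/
def extendZero (F : Type*) [Field F] (M : ℕ) : (Fin M → F) →ₗ[F] (ℕ → F) where
  toFun a n := if h : n < M then a ⟨n, h⟩ else 0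
  map_add' a b := by
    funext n
    by_cases h : n < M <;> simp [h]
  map_smul' c a := by
    funext n
    by_cases h : n < M <;> simp [h]

theorem extendZero_apply_of_lt {M n : ℕ} (a : Fin M → F) (h : n < M) :
    extendZero F M a n = a ⟨n, h⟩ := dif_pos h

theorem X_pow_dvd_oneAddTuple_sub {z : Fin s} {A A' : Fin s → ℕ → F} {m : ℕ}
    (h : ∀ i, ∀ n < m, A i n = A' i n) (i : Fin s) :
    (PowerSeries.X : PowerSeries F) ^ m ∣ oneAddTuple z A i - oneAddTuple z A' i := by
  rw [oneAddTuple, oneAddTuple]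
  split_ifs
  · simp
  · rw [add_sub_add_left_eq_sub, ← mul_sub]
    refine Dvd.dvd.mul_left ?_ _
    rw [PowerSeries.X_pow_dvd_iff]
    intro n hn
    rw [map_sub, PowerSeries.coeff_mk, PowerSeries.coeff_mk, h i n hn, sub_self]

/-- The linear part of the coefficients of `∑ i, oneAddTuple z A i * k i`. -/
noncomputable def solutionMap (z : Fin s) (k : Fin s → F[X]) (M n : ℕ) :
    (Fin s → Fin M → F) →ₗ[F] (Fin n → F) where
  toFun a l := PowerSeries.coeff l (∑ i ∈ Finset.univ.erase z,
    PowerSeries.mk (extendZero F M (a i)) * (k i : PowerSeries F))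
  map_add' a b := by
    funext l
    rw [Pi.add_apply, ← map_add, ← Finset.sum_add_distrib]
    congr 1
    refine Finset.sum_congr rfl fun i _ => ?_
    rw [← add_mul, Pi.add_apply, map_add]
    rfl
  map_smul' c a := by
    funext l
    rw [Pi.smul_apply, RingHom.id_apply, ← map_smul, Finset.smul_sum]
    congr 1
    refine Finset.sum_congr rfl fun i _ => ?_
    rw [← smul_mul_assoc, Pi.smul_apply, map_smul]
    rfl

theorem solutionMap_surjective {z i₀ : Fin s} (hi₀ : i₀ ≠ z) {k : Fin s → F[X]}
    (hk : (k i₀).coeff 0 ≠ 0) {M n : ℕ} (hn : n ≤ M) :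
    Function.Surjective (solutionMap z k M n) := by
  classical
  intro w
  have hunit : (k i₀ : PowerSeries F) * (k i₀ : PowerSeries F)⁻¹ = 1 :=
    PowerSeries.mul_inv_cancel _ (by
      rwa [← PowerSeries.coeff_zero_eq_constantCoeff_apply, Polynomial.coeff_coe])
  -- `k i₀` is a unit in the power series ring, so the coordinate `i₀` alone reaches every target.
  let u : PowerSeries F := PowerSeries.mk (extendZero F n w) * (k i₀ : PowerSeries F)⁻¹
  have hu : u * (k i₀ : PowerSeries F) = PowerSeries.mk (extendZero F n w) := by
    rw [mul_assoc, mul_comm _ (k i₀ : PowerSeries F), hunit, mul_one]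
  refine ⟨fun i j => if i = i₀ then PowerSeries.coeff j u else 0, ?_⟩
  funext l
  change PowerSeries.coeff l (∑ i ∈ Finset.univ.erase z, _) = w l
  rw [Finset.sum_eq_single_of_mem i₀ (Finset.mem_erase.2 ⟨hi₀, Finset.mem_univ _⟩)]
  · have hw : PowerSeries.coeff (l : ℕ) (u * (k i₀ : PowerSeries F)) = w l := by
      rw [hu, PowerSeries.coeff_mk, extendZero_apply_of_lt _ l.2]
    rw [← hw, PowerSeries.coeff_mul, PowerSeries.coeff_mul]
    refine Finset.sum_congr rfl fun p hp => ?_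
    have := Finset.HasAntidiagonal.mem_antidiagonal.1 hp
    have := l.2
    rw [PowerSeries.coeff_mk, extendZero_apply_of_lt _ (show p.1 < M by omega)]
    beta_reduce
    rw [if_pos rfl]
  · intro i _ hi
    have : (fun j : Fin M => if i = i₀ then PowerSeries.coeff (j : ℕ) u else 0) = 0 := by
      funext j
      rw [if_neg hi, Pi.zero_apply]
    beta_reduce
    rw [this, map_zero]
    exact zero_mul _

/-- The proportion of tuples solving a primitive congruence modulo `x ^ (n + 1)`. -/
theorem card_solutions_mul_le [Finite F] {z i₀ : Fin s} (hi₀ : i₀ ≠ z) {k : Fin s → F[X]}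
    (hk : (k i₀).coeff 0 ≠ 0) {M n : ℕ} (hn : n ≤ M) :
    Nat.card {a : Fin s → Fin M → F // (PowerSeries.X : PowerSeries F) ^ (n + 1) ∣
        ∑ i, oneAddTuple z (fun i => extendZero F M (a i)) i * (k i : PowerSeries F)}
      * Nat.card F ^ n ≤ Nat.card (Fin s → Fin M → F) := by
  classical
  -- Coefficient `0` of the congruence does not involve `a` and is dropped, hence `n` conditions for
  -- the modulus `x ^ (n + 1)`. The target `w` cancels the contribution of the constant terms `1` of
  -- `α`.
  let w : Fin n → F := fun l => - PowerSeries.coeff ((l : ℕ) + 1) (∑ i, (k i : PowerSeries F))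
  have h := card_fiber_mul_card _ (solutionMap_surjective hi₀ hk hn) w
  rw [Nat.card_fun, Nat.card_fin] at h
  rw [← h]
  refine Nat.mul_le_mul_right _ (Nat.card_le_card_of_injective
    (fun a => ⟨a.1, ?_⟩) fun a b hab => Subtype.ext (congrArg (fun c => c.1) hab))
  funext l
  have ha := PowerSeries.X_pow_dvd_iff.1 a.2 (l + 1) (by omega)
  have hsum : ∑ i, oneAddTuple z (fun i => extendZero F M (a.1 i)) i * (k i : PowerSeries F)
      = ∑ i, (k i : PowerSeries F) + PowerSeries.X * ∑ i ∈ Finset.univ.erase z,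
        PowerSeries.mk (extendZero F M (a.1 i)) * (k i : PowerSeries F) := by
    rw [← Finset.add_sum_erase _ _ (Finset.mem_univ z),
      ← Finset.add_sum_erase _ (fun i => (k i : PowerSeries F)) (Finset.mem_univ z), Finset.mul_sum,
      add_assoc, ← Finset.sum_add_distrib]
    congr 1
    · rw [oneAddTuple, if_pos rfl, one_mul]
    · refine Finset.sum_congr rfl fun i hi => ?_
      rw [oneAddTuple, if_neg (Finset.ne_of_mem_erase hi)]
      ring
  rw [hsum, map_add, PowerSeries.coeff_succ_X_mul] at ha
  exact eq_neg_of_add_eq_zero_right ha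

end

/-! ### The union bound over all possible obstructions at a fixed modulus. -/

section

variable {F : Type*} [Field F] {s : ℕ}

/-- The entry at `z` is determined by the sum and the others, each of which lies in `{0, …, n}`. -/
theorem card_piAntidiag_le (z : Fin s) (n : ℕ) :
    (Finset.piAntidiag (Finset.univ : Finset (Fin s)) n).card ≤ (n + 1) ^ (s - 1) := by
  classical
  have hcard : (Fintype.piFinset fun _ : {i : Fin s // i ≠ z} => Finset.range (n + 1)).card
      = (n + 1) ^ (s - 1) := by
    simp [Fintype.card_piFinset, Fintype.card_subtype_compl]
  rw [← hcard]
  refine Finset.card_le_card_of_injOn (fun d i => d i.1) (fun d hd => ?_) (fun d hd d' hd' h => ?_)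
  · have hd := (Finset.mem_piAntidiag.1 hd).1
    rw [Finset.mem_coe, Fintype.mem_piFinset]
    intro i
    rw [Finset.mem_range, Nat.lt_succ_iff, ← hd]
    exact Finset.single_le_sum (fun _ _ => Nat.zero_le _) (Finset.mem_univ i.1)
  · have hd := (Finset.mem_piAntidiag.1 hd).1
    have hd' := (Finset.mem_piAntidiag.1 hd').1
    have hne : ∀ i, i ≠ z → d i = d' i := fun i hi => congrFun h ⟨i, hi⟩
    have hsum : ∑ i ∈ Finset.univ.erase z, d i = ∑ i ∈ Finset.univ.erase z, d' i :=
      Finset.sum_congr rfl fun i hi => hne i (Finset.ne_of_mem_erase hi)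
    rw [← Finset.add_sum_erase _ _ (Finset.mem_univ z)] at hd hd'
    funext i
    by_cases hi : i = z
    · subst hi; omega
    · exact hne i hi

/-- Union bound over degree vectors `d`, exponents `v` and primitive tuples `c`. The power `q ^
(-v)` is weakened to `2 ^ (-v)`, so the sum over `v` costs at most a factor `2`. -/
theorem card_not_hasQuality_le [Finite F] (z : Fin s) {M m t : ℕ} (hmM : m ≤ M) (htm : t ≤ m) :
    (Nat.card {a : Fin s → Fin M → F //
        ¬ HasQuality (oneAddTuple z fun i => extendZero F M (a i)) m t} : ℝ) * (Nat.card F : ℝ) ^ t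
      ≤ 2 * Nat.card F * ((m : ℝ) + 1) ^ (s - 1) * Nat.card (Fin s → Fin M → F) := by
  classical
  have := Fintype.ofFinite F
  set q := Nat.card F with hq
  have hq1 : 1 < q := Finite.one_lt_card
  have hq0 : (0 : ℝ) < q := by exact_mod_cast (by omega : 0 < q)
  set Ω : ℝ := (Nat.card (Fin s → Fin M → F) : ℝ) with hΩ
  have hΩ0 : 0 ≤ Ω := Nat.cast_nonneg _
  let P : ∀ (d : Fin s → ℕ) (v : ℕ), (∀ i, Fin (d i - v) → F) → Fin s → F[X] :=
    fun d v c i => ((degreeLTEquiv F (d i - v)).symm (c i) : F[X])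
  let E : ∀ (d : Fin s → ℕ) (v : ℕ), (∀ i, Fin (d i - v) → F) → Finset (Fin s → Fin M → F) :=
    fun d v c => Finset.univ.filter fun a => (PowerSeries.X : PowerSeries F) ^ (m - v) ∣
      ∑ i, oneAddTuple z (fun i => extendZero F M (a i)) i * (P d v c i : PowerSeries F)
  let U : (Fin s → ℕ) → Finset ℕ :=
    fun d => (Finset.range m).filter fun v => (∑ i, (d i - v)) + 2 * v ≤ m - t
  let G : ∀ (d : Fin s → ℕ) (v : ℕ), Finset (∀ i, Fin (d i - v) → F) :=
    fun d v => Finset.univ.filter fun c => ∃ i, i ≠ z ∧ (P d v c i).coeff 0 ≠ 0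
  have hcover : (Finset.univ.filter fun a : Fin s → Fin M → F =>
      ¬ HasQuality (oneAddTuple z fun i => extendZero F M (a i)) m t) ⊆
      (Finset.piAntidiag Finset.univ (m - t)).biUnion fun d =>
        (U d).biUnion fun v => (G d v).biUnion fun c => E d v c := by
    intro a ha
    rw [Finset.mem_filter, HasQuality] at ha
    have ha := ha.2
    push Not at ha
    obtain ⟨d, hd, k, hk, hdvd, hk0⟩ := ha
    obtain ⟨v, k', hv, hk', hprim, hsum, hdvd'⟩ := exists_primitive_solution z
      (fun i => by rw [constantCoeff_oneAddTuple]; exact one_ne_zero)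
      (show ∑ i, d i ≤ m by omega) hk hk0 hdvd
    have hP : P d v (fun i => degreeLTEquiv F (d i - v) ⟨k' i, mem_degreeLT.2 (hk' i)⟩) = k' := by
      funext i
      simp only [P, LinearEquiv.symm_apply_apply]
    simp only [Finset.mem_biUnion]
    refine ⟨d, ?_, v, ?_, fun i => degreeLTEquiv F (d i - v) ⟨k' i, mem_degreeLT.2 (hk' i)⟩,
      ?_, ?_⟩
    · rw [Finset.mem_piAntidiag]
      exact ⟨Nat.eq_sub_of_add_eq hd, fun i _ => Finset.mem_univ i⟩
    · rw [Finset.mem_filter, Finset.mem_range]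
      exact ⟨hv, by omega⟩
    · rw [Finset.mem_filter, hP]
      exact ⟨Finset.mem_univ _, hprim⟩
    · rw [Finset.mem_filter, hP]
      exact ⟨Finset.mem_univ _, hdvd'⟩
  have hE : ∀ d v, v ∈ U d → ∀ c ∈ G d v, ((E d v c).card : ℝ) ≤ Ω / (q : ℝ) ^ (m - v - 1) := by
    intro d v hv c hc
    obtain ⟨i₀, hi₀, hc0⟩ := (Finset.mem_filter.1 hc).2
    have hvm := Finset.mem_range.1 (Finset.mem_filter.1 hv).1
    have h := card_solutions_mul_le hi₀ hc0 (M := M) (n := m - v - 1) (by omega)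
    rw [show m - v - 1 + 1 = m - v by omega, Nat.card_eq_fintype_card, Fintype.card_subtype] at h
    rw [le_div_iff₀ (by positivity), hΩ]
    exact_mod_cast h
  have hG : ∀ d v, ((G d v).card : ℝ) ≤ (q : ℝ) ^ ∑ i, (d i - v) := by
    intro d v
    have h : (G d v).card ≤ q ^ ∑ i, (d i - v) := by
      refine (Finset.card_le_univ _).trans_eq ?_
      rw [← Nat.card_eq_fintype_card, Nat.card_pi, ← Finset.prod_pow_eq_pow_sum]
      refine Finset.prod_congr rfl fun i _ => ?_
      rw [Nat.card_fun, Nat.card_fin]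
    exact_mod_cast h
  have hGE : ∀ d, ∀ v ∈ U d, (((G d v).biUnion fun c => E d v c).card : ℝ) * (q : ℝ) ^ t
      ≤ Ω * q * (1 / 2) ^ v := by
    intro d v hv
    have h1 : (((G d v).biUnion fun c => E d v c).card : ℝ)
        ≤ (q : ℝ) ^ (∑ i, (d i - v)) * (Ω / (q : ℝ) ^ (m - v - 1)) := by
      calc (((G d v).biUnion fun c => E d v c).card : ℝ)
          ≤ ∑ c ∈ G d v, ((E d v c).card : ℝ) := by exact_mod_cast Finset.card_biUnion_le
        _ ≤ (G d v).card • (Ω / (q : ℝ) ^ (m - v - 1)) :=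
          Finset.sum_le_card_nsmul _ _ _ (hE d v hv)
        _ ≤ _ := by
          rw [nsmul_eq_mul]
          exact mul_le_mul_of_nonneg_right (hG d v) (by positivity)
    have hv' := Finset.mem_filter.1 hv
    have hvm := Finset.mem_range.1 hv'.1
    have h2 : (q : ℝ) ^ (∑ i, (d i - v)) * (q : ℝ) ^ t * 2 ^ v ≤ q * (q : ℝ) ^ (m - v - 1) := by
      calc (q : ℝ) ^ (∑ i, (d i - v)) * (q : ℝ) ^ t * 2 ^ v
          ≤ (q : ℝ) ^ (∑ i, (d i - v)) * (q : ℝ) ^ t * (q : ℝ) ^ v := by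
            gcongr
            exact_mod_cast hq1
        _ = (q : ℝ) ^ (∑ i, (d i - v) + t + v) := by rw [pow_add, pow_add]
        _ ≤ (q : ℝ) ^ (m - v - 1 + 1) := by
            refine pow_le_pow_right₀ (by exact_mod_cast hq1.le) ?_
            have := hv'.2
            omega
        _ = _ := pow_succ' _ _
    calc (((G d v).biUnion fun c => E d v c).card : ℝ) * (q : ℝ) ^ t
        ≤ (q : ℝ) ^ (∑ i, (d i - v)) * (Ω / (q : ℝ) ^ (m - v - 1)) * (q : ℝ) ^ t :=
          mul_le_mul_of_nonneg_right h1 (by positivity)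
      _ = Ω * ((q : ℝ) ^ (∑ i, (d i - v)) * (q : ℝ) ^ t * 2 ^ v)
            / ((q : ℝ) ^ (m - v - 1) * 2 ^ v) := by field_simp
      _ ≤ Ω * (q * (q : ℝ) ^ (m - v - 1)) / ((q : ℝ) ^ (m - v - 1) * 2 ^ v) := by gcongr
      _ = Ω * q * (1 / 2) ^ v := by
          rw [one_div, inv_pow]
          field_simp
  have hU : ∀ d, (((U d).biUnion fun v => (G d v).biUnion fun c => E d v c).card : ℝ)
      * (q : ℝ) ^ t ≤ Ω * q * 2 := by
    intro d
    calc (((U d).biUnion fun v => (G d v).biUnion fun c => E d v c).card : ℝ) * (q : ℝ) ^ t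
        ≤ (∑ v ∈ U d, (((G d v).biUnion fun c => E d v c).card : ℝ)) * (q : ℝ) ^ t := by
          refine mul_le_mul_of_nonneg_right ?_ (by positivity)
          exact_mod_cast Finset.card_biUnion_le
      _ ≤ ∑ v ∈ U d, Ω * q * (1 / 2) ^ v := by
          rw [Finset.sum_mul]
          exact Finset.sum_le_sum (hGE d)
      _ ≤ ∑ v ∈ Finset.range m, Ω * q * (1 / 2) ^ v :=
          Finset.sum_le_sum_of_subset_of_nonneg (Finset.filter_subset _ _)
            fun _ _ _ => by positivity
      _ ≤ Ω * q * 2 := by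
          rw [← Finset.mul_sum]
          exact mul_le_mul_of_nonneg_left (sum_geometric_two_le m) (by positivity)
  rw [Nat.card_eq_fintype_card, Fintype.card_subtype]
  calc _ ≤ (∑ d ∈ Finset.piAntidiag Finset.univ (m - t),
        (((U d).biUnion fun v => (G d v).biUnion fun c => E d v c).card : ℝ)) * (q : ℝ) ^ t := by
        refine mul_le_mul_of_nonneg_right ?_ (by positivity)
        exact_mod_cast (Finset.card_le_card hcover).trans Finset.card_biUnion_le
    _ ≤ (Finset.piAntidiag (Finset.univ : Finset (Fin s)) (m - t)).card • (Ω * q * 2) := by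
        rw [Finset.sum_mul]
        exact Finset.sum_le_card_nsmul _ _ _ fun d _ => hU d
    _ ≤ ((m : ℝ) + 1) ^ (s - 1) * (Ω * q * 2) := by
        rw [nsmul_eq_mul]
        refine mul_le_mul_of_nonneg_right ?_ (by positivity)
        have h := (card_piAntidiag_le z (m - t)).trans
          (Nat.pow_le_pow_left (show m - t + 1 ≤ m + 1 by omega) (s - 1))
        exact_mod_cast h
    _ = _ := by ring

/-! ### Existence of good tuples -/

/-- A finite form of the Borel–Cantelli argument. -/
theorem exists_hasQuality_of_sum_lt_one [Finite F] (z : Fin s) (t : ℕ → ℕ) (ht : ∀ m, t m ≤ m)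
    (M : ℕ)
    (hsum : ∑ m ∈ (Finset.range (M + 1)).filter (fun m => t m < m),
      2 * (Nat.card F : ℝ) * ((m : ℝ) + 1) ^ (s - 1) / (Nat.card F : ℝ) ^ t m < 1) :
    ∃ a : Fin s → Fin M → F, ∀ m ≤ M,
      HasQuality (oneAddTuple z fun i => extendZero F M (a i)) m (t m) := by
  classical
  have := Fintype.ofFinite F
  by_contra! hcon
  have hq1 : 1 < Nat.card F := Finite.one_lt_card
  have hq0 : (0 : ℝ) < Nat.card F := by exact_mod_cast (by omega : 0 < Nat.card F)
  have hΩ : (0 : ℝ) < Nat.card (Fin s → Fin M → F) := by exact_mod_cast Nat.card_pos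
  let bad : ℕ → Finset (Fin s → Fin M → F) := fun m => Finset.univ.filter fun a =>
    ¬ HasQuality (oneAddTuple z fun i => extendZero F M (a i)) m (t m)
  have hcover : (Finset.univ : Finset (Fin s → Fin M → F)) ⊆
      ((Finset.range (M + 1)).filter fun m => t m < m).biUnion bad := by
    intro a _
    obtain ⟨m, hm, ha⟩ := hcon a
    rw [Finset.mem_biUnion]
    refine ⟨m, ?_, Finset.mem_filter.2 ⟨Finset.mem_univ _, ha⟩⟩
    rw [Finset.mem_filter, Finset.mem_range]
    refine ⟨by omega, lt_of_le_of_ne (ht m) fun h => ha ?_⟩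
    rw [h]
    exact hasQuality_self _ _
  have hle : (Nat.card (Fin s → Fin M → F) : ℝ) ≤
      ∑ m ∈ (Finset.range (M + 1)).filter (fun m => t m < m), ((bad m).card : ℝ) := by
    rw [Nat.card_eq_fintype_card, ← Finset.card_univ]
    exact_mod_cast (Finset.card_le_card hcover).trans Finset.card_biUnion_le
  have hbad : ∀ m ∈ (Finset.range (M + 1)).filter (fun m => t m < m), ((bad m).card : ℝ) ≤
      (2 * (Nat.card F : ℝ) * ((m : ℝ) + 1) ^ (s - 1) / (Nat.card F : ℝ) ^ t m)
        * Nat.card (Fin s → Fin M → F) := by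
    intro m hm
    have hmM : m ≤ M := Nat.lt_succ_iff.1 (Finset.mem_range.1 (Finset.mem_filter.1 hm).1)
    have h := card_not_hasQuality_le (F := F) z hmM (ht m)
    rw [Nat.card_eq_fintype_card, Fintype.card_subtype] at h
    rw [div_mul_eq_mul_div, le_div_iff₀ (by positivity)]
    exact h
  have := hle.trans (Finset.sum_le_sum hbad)
  rw [← Finset.sum_mul] at this
  nlinarith

/-- Compactness: if all finite sets of quality requirements can be met, then all can be. -/
theorem exists_hasQuality_of_forall_finite [Finite F] (z : Fin s) (t : ℕ → ℕ)
    (h : ∀ M, ∃ a : Fin s → Fin M → F, ∀ m ≤ M,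
      HasQuality (oneAddTuple z fun i => extendZero F M (a i)) m (t m)) :
    ∃ A : Fin s → ℕ → F, ∀ m, HasQuality (oneAddTuple z A) m (t m) := by
  let _ : TopologicalSpace F := ⊥
  have : DiscreteTopology F := ⟨rfl⟩
  let ρ : ∀ M, (Fin s → ℕ → F) → Fin s → Fin M → F := fun M A i j => A i j
  have hρ : ∀ M, Continuous (ρ M) := fun M => by fun_prop
  have hext : ∀ M A, ∀ m ≤ M, ∀ i, ∀ n < m, extendZero F M (ρ M A i) n = A i n :=
    fun M A m hm i n hn => extendZero_apply_of_lt _ (by omega)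
  let K : ℕ → Set (Fin s → ℕ → F) := fun M => {A | ∀ m ≤ M, HasQuality (oneAddTuple z A) m (t m)}
  have hK : ∀ M, K M = ρ M ⁻¹' {a | ∀ m ≤ M,
      HasQuality (oneAddTuple z fun i => extendZero F M (a i)) m (t m)} := by
    intro M
    ext A
    refine forall₂_congr fun m hm => ⟨fun hA => ?_, fun hA => ?_⟩
    · exact hA.congr (X_pow_dvd_oneAddTuple_sub fun i n hn => (hext M A m hm i n hn).symm)
    · exact hA.congr (X_pow_dvd_oneAddTuple_sub fun i n hn => hext M A m hm i n hn)
  -- `K M` is the preimage of a subset of a discrete space under restriction to the first `M`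
  -- coefficients.
  have hclosed : ∀ M, IsClosed (K M) := fun M => by
    rw [hK]
    exact (isClosed_discrete _).preimage (hρ M)
  obtain ⟨A, hA⟩ := IsCompact.nonempty_iInter_of_sequence_nonempty_isCompact_isClosed K
    (fun M A hA m hm => hA m (by omega))
    (fun M => by
      obtain ⟨a, ha⟩ := h M
      refine ⟨fun i => extendZero F M (a i), ?_⟩
      exact ha)
    (hclosed 0).isCompact hclosed
  exact ⟨A, fun m => Set.mem_iInter.1 hA m m le_rfl⟩

theorem mem_Y_of_constantCoeff_eq_one {a : PowerSeries F} (ha : PowerSeries.constantCoeff a = 1) :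
    a ∈ Y F := by
  intro m hm
  refine IsCoprime.pow_right ?_
  refine ((Polynomial.irreducible_X (R := F)).coprime_iff_not_dvd.2 ?_).symm
  rw [Polynomial.X_dvd_iff, PowerSeries.coeff_trunc, if_pos (by omega),
    PowerSeries.coeff_zero_eq_constantCoeff_apply, ha]
  exact one_ne_zero

end

end HyperplaneSeq

/-! ### Choice of `L` and `T`, and assembly. -/

theorem mainTheorem1 (q s : ℕ) [NeZero q] (hq : IsPrimePow q) (hs : 1 ≤ s)
    (β : ℕ → ℝ) (hβ_pos : ∀ m : ℕ, 1 ≤ m → 0 < β m) (hβ_sum : Summable β) :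
    ∃ L : ℤ, ∀ (F : Type*) [Field F], Nat.card F = q →
      ∃ α : Fin s → PowerSeries F,
        (∀ i, α i ∈ HyperplaneSeq.Y F) ∧ α ⟨0, hs⟩ = 1 ∧
        ∀ φ : Fin q ≃ F, φ 0 = 0 →
        ∀ B : (m : ℕ) → Fin s → Module.Basis (Fin m) F (HyperplaneSeq.R F m),
          HyperplaneSeq.CompatibleBases B →
          (∃ C : Fin s → Matrix ℕ ℕ F, HyperplaneSeq.IsHyperplaneGenerating B α C) ∧
          ∀ C : Fin s → Matrix ℕ ℕ F, HyperplaneSeq.IsHyperplaneGenerating B α C →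
            ∃ T : ℕ → ℕ, HyperplaneSeq.IsDigitalTSSequence φ C T ∧
              ∀ m : ℕ, 1 ≤ m →
                (T m : ℝ) ≤ Real.logb q ((m : ℝ) ^ (s - 1) / β m) + (L : ℝ) := by
  have hq1 : 1 < q := hq.one_lt
  have hq1' : (1 : ℝ) < q := by exact_mod_cast hq1
  have hq0 : (0 : ℝ) < q := by linarith
  -- Absolute values, since the sign of `β 0` is unrestricted.
  set S : ℝ := ∑' m, |β m| with hS
  have hS0 : 0 ≤ S := tsum_nonneg fun _ => abs_nonneg _
  have hβS : ∀ m, β m ≤ S := fun m =>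
    (le_abs_self _).trans (hβ_sum.abs.le_tsum m fun _ _ => abs_nonneg _)
  -- The factor `2 ^ (s - 1)` absorbs `m + 1 ≤ 2 * m`. This size of `L₀` makes the total failure
  -- probability less than `1` and also gives `β m ≤ q ^ L₀`, hence `0 ≤ x m + L₀`.
  obtain ⟨L₀, hL₀⟩ := pow_unbounded_of_one_lt (2 * q * 2 ^ (s - 1) * (S + 1)) hq1'
  have hL₀S : S ≤ (q : ℝ) ^ L₀ := by
    have h1 : (1 : ℝ) ≤ 2 ^ (s - 1) := one_le_pow₀ (by norm_num)
    have h2 : (1 : ℝ) ≤ 2 * q * 2 ^ (s - 1) := by nlinarith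
    nlinarith
  let x : ℕ → ℝ := fun m => Real.logb q ((m : ℝ) ^ (s - 1) / β m)
  have harg : ∀ m : ℕ, 1 ≤ m → 0 < (m : ℝ) ^ (s - 1) / β m := fun m hm =>
    div_pos (pow_pos (Nat.cast_pos.2 hm) _) (hβ_pos m hm)
  have hx : ∀ m : ℕ, 1 ≤ m → 0 ≤ x m + L₀ := by
    intro m hm
    have h1 : (q : ℝ) ^ (-(L₀ : ℝ)) ≤ (m : ℝ) ^ (s - 1) / β m := by
      rw [Real.rpow_neg hq0.le, Real.rpow_natCast, le_div_iff₀ (hβ_pos m hm),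
        inv_mul_le_iff₀ (by positivity)]
      have h2 : (1 : ℝ) ≤ (m : ℝ) ^ (s - 1) := one_le_pow₀ (by exact_mod_cast hm)
      have h3 := hβS m
      have h4 : (0 : ℝ) < (q : ℝ) ^ L₀ := by positivity
      nlinarith
    have := (Real.le_logb_iff_rpow_le hq1' (harg m hm)).2 h1
    simp only [x]
    linarith
  -- Where the minimum is `m`, quality is automatic, so only indices with `t m < m` enter the
  -- probability sum.
  let t : ℕ → ℕ := fun m => min m ⌈x m + L₀⌉₊
  have ht : ∀ m, t m ≤ m := fun m => min_le_left _ _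
  have hterm : ∀ m, t m < m → 2 * (q : ℝ) * ((m : ℝ) + 1) ^ (s - 1) / (q : ℝ) ^ t m
      ≤ 2 * q * 2 ^ (s - 1) / (q : ℝ) ^ L₀ * |β m| := by
    intro m hm
    have hm1 : 1 ≤ m := by omega
    have htm : t m = ⌈x m + L₀⌉₊ := by
      rcases min_choice m ⌈x m + L₀⌉₊ with h | h
      · exact absurd h hm.ne
      · exact h
    have h1 : x m + L₀ ≤ (t m : ℝ) := by rw [htm]; exact Nat.le_ceil _
    have h2 : (m : ℝ) ^ (s - 1) / β m * (q : ℝ) ^ L₀ ≤ (q : ℝ) ^ t m := by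
      have h3 := Real.rpow_le_rpow_of_exponent_le hq1'.le h1
      rwa [Real.rpow_add hq0, Real.rpow_natCast, Real.rpow_natCast,
        Real.rpow_logb hq0 hq1'.ne' (harg m hm1)] at h3
    have h4 : ((m : ℝ) + 1) ^ (s - 1) ≤ 2 ^ (s - 1) * (m : ℝ) ^ (s - 1) := by
      rw [← mul_pow]
      have : (1 : ℝ) ≤ m := by exact_mod_cast hm1
      gcongr
      linarith
    have hβ := hβ_pos m hm1
    have hm0 : (0 : ℝ) < (m : ℝ) ^ (s - 1) := pow_pos (by exact_mod_cast hm1) _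
    rw [abs_of_pos hβ]
    calc 2 * (q : ℝ) * ((m : ℝ) + 1) ^ (s - 1) / (q : ℝ) ^ t m
        ≤ 2 * (q : ℝ) * (2 ^ (s - 1) * (m : ℝ) ^ (s - 1))
          / ((m : ℝ) ^ (s - 1) / β m * (q : ℝ) ^ L₀) := by gcongr
      _ = _ := by field_simp
  -- The extra `1` pays for rounding up; `L` is fixed before the field and `α`.
  refine ⟨(L₀ : ℤ) + 1, fun F _ hF => ?_⟩
  have : Finite F := Nat.finite_of_card_ne_zero (by omega)
  obtain ⟨A, hA⟩ := HyperplaneSeq.exists_hasQuality_of_forall_finite (F := F) (⟨0, hs⟩ : Fin s) t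
    fun M => HyperplaneSeq.exists_hasQuality_of_sum_lt_one _ t ht M (by
      rw [hF]
      calc _ ≤ ∑ m ∈ (Finset.range (M + 1)).filter (fun m => t m < m),
            2 * (q : ℝ) * 2 ^ (s - 1) / (q : ℝ) ^ L₀ * |β m| :=
            Finset.sum_le_sum fun m hm => hterm m (Finset.mem_filter.1 hm).2
        _ ≤ 2 * (q : ℝ) * 2 ^ (s - 1) / (q : ℝ) ^ L₀ * S := by
            rw [← Finset.mul_sum]
            exact mul_le_mul_of_nonneg_left
              (hβ_sum.abs.sum_le_tsum _ fun _ _ => abs_nonneg _) (by positivity)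
        _ < 1 := by
            rw [div_mul_eq_mul_div, div_lt_one (by positivity)]
            refine lt_of_le_of_lt ?_ hL₀
            gcongr
            linarith)
  refine ⟨HyperplaneSeq.oneAddTuple ⟨0, hs⟩ A, fun i =>
    HyperplaneSeq.mem_Y_of_constantCoeff_eq_one (HyperplaneSeq.constantCoeff_oneAddTuple _ _ _),
    if_pos rfl, fun φ hφ B hB =>
      ⟨⟨_, HyperplaneSeq.isHyperplaneGenerating_canonicalMatrices hB _⟩, fun C hC =>
        ⟨t, HyperplaneSeq.isDigitalTSSequence_of_hasQuality hq1 φ hφ hB hC ht hA,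
          fun m hm => ?_⟩⟩⟩
  have h1 : (t m : ℝ) ≤ (⌈x m + L₀⌉₊ : ℝ) := by exact_mod_cast min_le_right _ _
  have h2 := Nat.ceil_lt_add_one (hx m hm)
  push_cast
  simp only [x] at h1 h2
  linarith
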